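/- Let $X$ be a compact geodesic metric space (every two points are joined by a length-minimizing curve whose length is their distance) that is semilocally simply connected (every point $x$ has a neighborhood $U$ such that every loop in $U$ based at $x$ is null-homotopic in $X$). For $\varepsilon>0$, an $\varepsilon$-chain in $X$ is a finite sequence $x_0,\dots,x_n$ ($n\ge 0$) of points of $X$ with $d(x_i,x_{i+1})<\varepsilon$ for all $i$; it is an $\varepsilon$-loop if $x_n=x_0$. Two $\varepsilon$-chains with the same endpoints are $\varepsilon$-homotopic if one is obtained from the other by finitely many moves, each adding or removing a single point, such that every intermediate sequence is an $\varepsilon$-chain with the same endpoints. An $\varepsilon$-loop is $\varepsilon$-null if it is $\varepsilon$-homotopic to the one-point chain at its starting point. The homotopy critical spectrum of $X$ is the set of all $\varepsilon>0$ for which there is an $\varepsilon$-loop that is not $\varepsilon$-null but is $\delta$-null for every $\delta>\varepsilon$. For $g\in\pi_1(X,*)$, let $|g|\in[0,\infty]$ be the infimum of the lengths of the loops in the homotopy class $g$. For $L>0$, let $\Gamma(X,L)$ be the supremum, over all basepoints $*\in X$, of the number of distinct elements $g\in\pi_1(X,*)$ with $|g|\le L$. For $s>0$, let $C(X,s)$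 be the minimum number of open $s$-balls required to cover $X$. If $\varepsilon>0$ is a lower bound for the homotopy critical spectrum of $X$ (that is, $\varepsilon\le\sigma$ for every element $\sigma$ of the spectrum; every $\varepsilon>0$ is one if the spectrum is empty), then for every $L>0$, $$\Gamma(X,L)\;\le\; C\!\left(X,\tfrac{\varepsilon}{4}\right)^{4L/\varepsilon}.$$ -/

import Mathlib

open scoped ENNReal Topology

namespace DiscreteHomotopy

section Spaces

/-- A metric space is geodesic if any two points `x`, `y` are joined by a geodesic, that is, an
arclength parameterized length minimizing curve: a map of `[0, dist x y]` into the space that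
preserves distances. -/
def IsGeodesicSpace (X : Type*) [MetricSpace X] : Prop :=
  ∀ x y : X, ∃ c : ℝ → X, c 0 = x ∧ c (dist x y) = y ∧
    ∀ s ∈ Set.Icc 0 (dist x y), ∀ t ∈ Set.Icc 0 (dist x y), dist (c s) (c t) = |s - t|

/-- Every point has a neighborhood `U` such that each loop in `U` based at that point is
null-homotopic in the whole space (with fixed endpoints). -/
def IsSemilocallySimplyConnected (X : Type*) [TopologicalSpace X] : Prop :=
  ∀ x : X, ∃ U ∈ 𝓝 x, ∀ γ : Path x x, Set.range γ ⊆ U → γ.Homotopic (Path.refl x)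

end Spaces

section Chains

variable {X : Type*} [MetricSpace X]

/-- An `ε`-chain `{x₀, ..., xₙ}`: a nonempty finite sequence whose successive points are at
distance less than `ε`. -/
def IsEpsChain (ε : ℝ) (α : List X) : Prop :=
  α ≠ [] ∧ List.IsChain (fun x y => dist x y < ε) α

/-- An `ε`-loop is an `ε`-chain with equal first and last points. -/
def IsEpsLoop (ε : ℝ) (α : List X) : Prop :=
  IsEpsChain ε α ∧ α.head? = α.getLast?

/-- `β` is obtained from the `ε`-chain `α` by adding a single point; both are `ε`-chains and have
the same endpoints. -/
def AddsPoint (ε : ℝ) (α β : List X) : Prop :=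
  IsEpsChain ε α ∧ IsEpsChain ε β ∧ α.head? = β.head? ∧ α.getLast? = β.getLast? ∧
    ∃ (a b : List X) (p : X), α = a ++ b ∧ β = a ++ p :: b

/-- A basic move with fixed endpoints: adding or removing a single point. -/
def BasicMove (ε : ℝ) (α β : List X) : Prop :=
  AddsPoint ε α β ∨ AddsPoint ε β α

/-- `α` and `β` are `ε`-chains joined by a finite sequence of `ε`-chains with the same endpoints,
successive ones differing by a basic move. -/
def EpsHomotopic (ε : ℝ) (α β : List X) : Prop :=
  IsEpsChain ε α ∧ IsEpsChain ε β ∧ Relation.ReflTransGen (BasicMove ε) α β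

/-- A loop is `ε`-null if it is `ε`-homotopic to a trivial loop `{x₀}`; since `ε`-homotopies fix
endpoints, `x₀` is the first and last point of the loop. -/
def IsEpsNull (ε : ℝ) (α : List X) : Prop :=
  ∃ x₀ : X, EpsHomotopic ε α [x₀]

/-- An `ε`-loop is `ε`-critical if it is not `ε`-null but is `δ`-null for all `δ > ε`. -/
def IsEpsCritical (ε : ℝ) (α : List X) : Prop :=
  IsEpsLoop ε α ∧ ¬ IsEpsNull ε α ∧ ∀ δ : ℝ, ε < δ → IsEpsNull δ α

variable (X) in
/-- The homotopy critical spectrum: all `ε > 0` for which an `ε`-critical `ε`-loop exists. -/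
def homotopyCriticalSpectrum : Set ℝ :=
  {ε : ℝ | 0 < ε ∧ ∃ α : List X, IsEpsCritical ε α}

end Chains

section Counting

variable {X : Type*} [MetricSpace X]

/-- The length (possibly infinite) of a path in a metric space: the supremum of the lengths of
inscribed polygons. -/
noncomputable def pathLength {x y : X} (γ : Path x y) : ℝ≥0∞ :=
  eVariationOn (γ : unitInterval → X) Set.univ

/-- `|[c]|`: the infimum of the lengths of the paths in a fixed-endpoint homotopy class. -/
noncomputable def classLength {x y : X} (g : Path.Homotopic.Quotient x y) : ℝ≥0∞ :=
  ⨅ (γ : Path x y) (_ : Path.Homotopic.Quotient.mk γ = g), pathLength γ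

variable (X) in
/-- `Γ(X, L)`: the supremum over all basepoints of the number of elements `g` of the fundamental
group with `|g| ≤ L`. -/
noncomputable def shortClassCount (L : ℝ) : ℕ∞ :=
  ⨆ x : X, {g : FundamentalGroup X x | classLength g.toPath ≤ ENNReal.ofReal L}.encard

variable (X) in
/-- `C(X, s)`: the minimum number of open `s`-balls required to cover `X`. -/
noncomputable def openCoverNumber (s : ℝ) : ℕ∞ :=
  ⨅ (A : Set X) (_ : (⋃ a ∈ A, Metric.ball a s) = Set.univ), A.encard

end Counting

end DiscreteHomotopy

namespace DiscreteHomotopy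

/-! ### Chains, moves and dependence on the scale -/

section ChainMoves

variable {X : Type*} [MetricSpace X] {ε δ : ℝ} {α β γ : List X}

/-! Each short class is encoded by a word of `n = ⌈4L/ε⌉ - 1` centers of a minimal cover by
`ε/4`-balls, and the code is injective. Cut a representative of length just above `L` at most into
`n + 1` blocks of length about `ε/4`, and record a center near each of the `n` interior cut points;
the two ends are the basepoint and cost nothing.

If two classes share a code, corresponding cut points are less than `ε/2` apart, so fine
subdivisions of the two loops bound a ladder whose cells collapse at scale `ε`
(`IsEpsNull.of_ladder`). The loop formed by one subdivision and the reverse of the other is thus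
`ε`-null. It is also a `δ`-loop for a tiny `δ`, and no critical value lies below `ε`, so it is
`δ`-null (`IsEpsNull.of_mem_lowerBounds`).

At such a scale, sending each step of a chain to the class of a short geodesic gives a product in
the fundamental group that is invariant under moves. Nullity therefore makes the two paths homotopic
(`homotopic_of_isEpsNull`). -/

theorem IsEpsChain.mono (h : IsEpsChain δ α) (hδ : δ ≤ ε) : IsEpsChain ε α :=
  ⟨h.1, h.2.imp fun _ _ hd => hd.trans_le hδ⟩

theorem AddsPoint.mono (h : AddsPoint δ α β) (hδ : δ ≤ ε) : AddsPoint ε α β :=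
  ⟨h.1.mono hδ, h.2.1.mono hδ, h.2.2⟩

theorem BasicMove.mono (h : BasicMove δ α β) (hδ : δ ≤ ε) : BasicMove ε α β :=
  h.imp (·.mono hδ) (·.mono hδ)

theorem EpsHomotopic.mono (h : EpsHomotopic δ α β) (hδ : δ ≤ ε) : EpsHomotopic ε α β :=
  ⟨h.1.mono hδ, h.2.1.mono hδ, Relation.ReflTransGen.mono (fun _ _ hm => BasicMove.mono hm hδ) _ _ h.2.2⟩

theorem IsEpsNull.mono (h : IsEpsNull δ α) (hδ : δ ≤ ε) : IsEpsNull ε α :=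
  let ⟨x, hx⟩ := h
  ⟨x, hx.mono hδ⟩

/-- Finitely many strict inequalities leave room. Through the lemmas below, nullity becomes an open
condition on the scale. -/
theorem IsEpsChain.exists_lt (h : IsEpsChain ε α) : ∃ δ < ε, IsEpsChain δ α := by
  obtain ⟨hne, hc⟩ := h
  induction α with
  | nil => exact absurd rfl hne
  | cons a l ih =>
    cases l with
    | nil => exact ⟨ε - 1, by linarith, by simp, by simp⟩
    | cons b l =>
      rw [List.isChain_cons_cons] at hc
      obtain ⟨δ, hδ, -, hch⟩ := ih (by simp) hc.2
      obtain ⟨t, ht, htε⟩ := exists_between (max_lt hδ hc.1)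
      refine ⟨t, htε, by simp, ?_⟩
      rw [List.isChain_cons_cons]
      exact ⟨(le_max_right _ _).trans_lt ht,
        hch.imp fun _ _ hd => hd.trans ((le_max_left _ _).trans_lt ht)⟩

theorem AddsPoint.exists_lt (h : AddsPoint ε α β) : ∃ δ < ε, AddsPoint δ α β := by
  obtain ⟨δ₁, h₁, hα⟩ := h.1.exists_lt
  obtain ⟨δ₂, h₂, hβ⟩ := h.2.1.exists_lt
  exact ⟨max δ₁ δ₂, max_lt h₁ h₂, hα.mono (le_max_left _ _), hβ.mono (le_max_right _ _), h.2.2⟩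

theorem BasicMove.exists_lt (h : BasicMove ε α β) : ∃ δ < ε, BasicMove δ α β := by
  rcases h with h | h
  · obtain ⟨δ, hδ, h⟩ := h.exists_lt
    exact ⟨δ, hδ, .inl h⟩
  · obtain ⟨δ, hδ, h⟩ := h.exists_lt
    exact ⟨δ, hδ, .inr h⟩

theorem EpsHomotopic.exists_lt (h : EpsHomotopic ε α β) : ∃ δ < ε, EpsHomotopic δ α β := by
  obtain ⟨hα, hβ, hm⟩ := h
  suffices H : ∃ δ < ε, Relation.ReflTransGen (BasicMove δ) α β by
    obtain ⟨δ, hδ, h⟩ := H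
    obtain ⟨δ₁, h₁, hα⟩ := hα.exists_lt
    obtain ⟨δ₂, h₂, hβ⟩ := hβ.exists_lt
    refine ⟨max δ (max δ₁ δ₂), max_lt hδ (max_lt h₁ h₂), hα.mono (by simp), hβ.mono (by simp),
      Relation.ReflTransGen.mono (fun _ _ hm => BasicMove.mono hm (le_max_left _ _)) _ _ h⟩
  clear hα hβ
  induction hm with
  | refl => exact ⟨ε - 1, by linarith, .refl⟩
  | tail _ hs ih =>
    obtain ⟨δ₁, h₁, hα⟩ := ih
    obtain ⟨δ₂, h₂, hβ⟩ := hs.exists_lt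
    exact ⟨max δ₁ δ₂, max_lt h₁ h₂,
      .tail (Relation.ReflTransGen.mono (fun _ _ hm => BasicMove.mono hm (le_max_left _ _)) _ _ hα)
        (hβ.mono (le_max_right _ _))⟩

theorem IsEpsNull.exists_lt (h : IsEpsNull ε α) : ∃ δ < ε, IsEpsNull δ α := by
  obtain ⟨x, hx⟩ := h
  obtain ⟨δ, hδ, h⟩ := hx.exists_lt
  exact ⟨δ, hδ, x, h⟩

/-- Below the homotopy critical spectrum, nullity of a loop does not depend on the scale. -/
theorem IsEpsNull.of_mem_lowerBounds (hlower : ε ∈ lowerBounds (homotopyCriticalSpectrum X))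
    (hδ : 0 < δ) (hα : IsEpsLoop δ α) (hnull : IsEpsNull ε α) : IsEpsNull δ α := by
  by_contra hnot
  set S : Set ℝ := {t | IsEpsNull t α}
  have hεS : ε ∈ S := hnull
  have hlb : δ ∈ lowerBounds S := fun t ht => by
    by_contra! hlt
    exact hnot (IsEpsNull.mono ht hlt.le)
  have hbdd : BddBelow S := ⟨δ, hlb⟩
  have hle : δ ≤ sInf S := le_csInf ⟨ε, hεS⟩ hlb
  -- Openness prevents the infimum of the null scales from being attained, so that infimum is a
  -- critical value. The lower bound then forces it to equal `ε`, which does lie in `S`.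
  have hnmem : sInf S ∉ S := fun h => by
    obtain ⟨t, ht, htS⟩ := IsEpsNull.exists_lt h
    exact absurd (csInf_le hbdd htS) (not_le.2 ht)
  have hcrit : IsEpsCritical (sInf S) α :=
    ⟨⟨hα.1.mono hle, hα.2⟩, hnmem, fun t ht => by
      obtain ⟨s, hs, hst⟩ := exists_lt_of_csInf_lt ⟨ε, hεS⟩ ht
      exact IsEpsNull.mono hs hst.le⟩
  have := hlower ⟨hδ.trans_le hle, α, hcrit⟩
  exact hnmem ((le_antisymm this (csInf_le hbdd hεS)) ▸ hεS)

theorem EpsHomotopic.trans (h : EpsHomotopic ε α β) (h' : EpsHomotopic ε β γ) :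
    EpsHomotopic ε α γ :=
  ⟨h.1, h'.2.1, h.2.2.trans h'.2.2⟩

theorem EpsHomotopic.symm (h : EpsHomotopic ε α β) : EpsHomotopic ε β α :=
  have : Std.Symm (BasicMove (X := X) ε) := ⟨fun _ _ hm => hm.symm⟩
  ⟨h.2.1, h.1, Std.Symm.symm _ _ h.2.2⟩

theorem IsEpsChain.reverse (h : IsEpsChain ε α) : IsEpsChain ε α.reverse :=
  ⟨by simpa using h.1, by simpa [List.isChain_reverse, flip, dist_comm] using h.2⟩

theorem AddsPoint.reverse (h : AddsPoint ε α β) : AddsPoint ε α.reverse β.reverse := by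
  obtain ⟨h₁, h₂, h₃, h₄, a, b, p, rfl, rfl⟩ := h
  refine ⟨h₁.reverse, h₂.reverse, ?_, ?_, b.reverse, a.reverse, p, by simp, by simp⟩
  · rw [List.head?_reverse, List.head?_reverse, h₄]
  · rw [List.getLast?_reverse, List.getLast?_reverse, h₃]

theorem EpsHomotopic.reverse (h : EpsHomotopic ε α β) :
    EpsHomotopic ε α.reverse β.reverse :=
  ⟨h.1.reverse, h.2.1.reverse,
    h.2.2.lift _ fun _ _ hm => hm.imp AddsPoint.reverse AddsPoint.reverse⟩

theorem EpsHomotopic.remove {l r : List X} {a p b : X} (h : IsEpsChain ε (l ++ a :: p :: b :: r))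
    (hab : dist a b < ε) : EpsHomotopic ε (l ++ a :: p :: b :: r) (l ++ a :: b :: r) := by
  have h' : IsEpsChain ε (l ++ a :: b :: r) := by
    refine ⟨by simp, ?_⟩
    have := h.2
    simp only [List.isChain_append_cons_cons, List.isChain_cons_cons] at this ⊢
    exact ⟨this.1, hab, this.2.2.2⟩
  refine ⟨h, h', .single (.inr ⟨h', h, ?_, ?_, l ++ [a], b :: r, p, by simp, by simp⟩)⟩
  · cases l <;> simp
  · simp [List.getLast?_append, List.getLast?_cons]

theorem EpsHomotopic.duplicate (hε : 0 < ε) {l r : List X} {a : X}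
    (h : IsEpsChain ε (l ++ a :: r)) : EpsHomotopic ε (l ++ a :: r) (l ++ a :: a :: r) := by
  have h' : IsEpsChain ε (l ++ a :: a :: r) := by
    refine ⟨by simp, ?_⟩
    have := h.2
    rw [List.isChain_split] at this
    rw [List.isChain_append_cons_cons]
    exact ⟨this.1, by simpa, this.2⟩
  refine ⟨h, h', .single (.inl ⟨h, h', ?_, ?_, l ++ [a], r, a, by simp, by simp⟩)⟩
  · cases l <;> simp
  · simp [List.getLast?_append, List.getLast?_cons]

end ChainMoves

/-! ### Chains indexed by natural numbers -/

section InitialSegment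

variable {X : Type*}

/-- The list `y 0, ..., y n`. -/
def initialSegment (y : ℕ → X) (n : ℕ) : List X :=
  (List.range (n + 1)).map y

theorem initialSegment_succ (y : ℕ → X) (n : ℕ) :
    initialSegment y (n + 1) = initialSegment y n ++ [y (n + 1)] := by
  simp [initialSegment, List.range_succ]

theorem initialSegment_eq_append (y : ℕ → X) (n : ℕ) :
    initialSegment y n = (List.range n).map y ++ [y n] := by
  simp [initialSegment, List.range_succ]

theorem isChain_initialSegment {R : X → X → Prop} {y : ℕ → X} {n : ℕ}
    (h : ∀ i < n, R (y i) (y (i + 1))) : (initialSegment y n).IsChain R := by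
  induction n with
  | zero => simp [initialSegment]
  | succ n ih =>
    have := ih fun i hi => h i (by omega)
    rw [initialSegment_eq_append] at this
    rw [initialSegment_succ, initialSegment_eq_append, List.append_assoc, List.singleton_append,
      List.isChain_append_cons_cons]
    exact ⟨this, h n (by omega), by simp⟩

end InitialSegment

/-! ### Collapsing ladders and cutting into blocks -/

section Segments

variable {X : Type*} [MetricSpace X] {ε : ℝ}

theorem EpsHomotopic.collapse (hε : 0 < ε) {y : ℕ → X} {a b : ℕ} (hab : a ≤ b)
    (hy : ∀ i j, a ≤ i → i ≤ j → j ≤ b → dist (y i) (y j) < ε) (r : List X)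
    (h : IsEpsChain ε (initialSegment y b ++ r)) :
    EpsHomotopic ε (initialSegment y b ++ r) (initialSegment y a ++ y b :: r) := by
  induction b, hab using Nat.le_induction generalizing r with
  | base =>
    -- For `a = b` the target repeats `y a`, hence a duplication move.
    rw [initialSegment_eq_append, List.append_assoc, List.append_assoc] at *
    exact .duplicate hε h
  | succ b hab ih =>
    rw [initialSegment_succ, List.append_assoc] at h ⊢
    have h₁ := ih (fun i j hi hij hj => hy i j hi hij (by omega)) _ h
    refine h₁.trans ?_
    have h₂ := h₁.2.1
    rw [initialSegment_eq_append, List.append_assoc] at h₂ ⊢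
    rw [List.append_assoc]
    exact .remove h₂ (hy _ _ le_rfl (by omega) le_rfl)

theorem EpsHomotopic.ladder_step (hε : 0 < ε) {y z : ℕ → X} {a b c d : ℕ} (hab : a ≤ b)
    (hcd : c ≤ d)
    (hy : ∀ i j, a ≤ i → i ≤ j → j ≤ b → dist (y i) (y j) < ε)
    (hz : ∀ i j, c ≤ i → i ≤ j → j ≤ d → dist (z i) (z j) < ε)
    (hcb : dist (z c) (y b) < ε) (hca : dist (z c) (y a) < ε)
    (h : IsEpsChain ε (initialSegment y b ++ (initialSegment z d).reverse)) :
    EpsHomotopic ε (initialSegment y b ++ (initialSegment z d).reverse)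
      (initialSegment y a ++ (initialSegment z c).reverse) := by
  have h₁ := EpsHomotopic.collapse hε hab hy _ h
  have h₂ := h₁.reverse
  simp only [List.reverse_append, List.reverse_cons, List.reverse_reverse, List.append_assoc,
    List.singleton_append] at h₂
  have h₃ := h₂.trans (EpsHomotopic.collapse hε hcd hz _ h₂.2.1)
  have hy' : (initialSegment y a).reverse = y a :: ((List.range a).map y).reverse := by
    simp [initialSegment_eq_append]
  rw [hy', initialSegment_eq_append z c, List.append_assoc, List.singleton_append] at h₃
  -- The chain now passes through `z c, z d, y b, y a`. Drop `z d` using the diagonal of the cell,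
  -- then `y b` using its rung.
  have h₄ := h₃.trans (.remove h₃.2.1 hcb)
  have h₅ := (h₄.trans (.remove h₄.2.1 hca)).reverse
  simpa [initialSegment_eq_append] using h₅

/-- Two subdivided loops whose blocks fellow-travel at scale `ε` together form a null loop. -/
theorem IsEpsNull.of_ladder (hε : 0 < ε) {y z : ℕ → X} {J K : ℕ → ℕ} {N : ℕ}
    (hJ : Monotone J) (hK : Monotone K) (hJ₀ : J 0 = 0) (hK₀ : K 0 = 0) (h₀ : y 0 = z 0)
    (hy : ∀ k < N, ∀ i j, J k ≤ i → i ≤ j → j ≤ J (k + 1) → dist (y i) (y j) < ε)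
    (hz : ∀ k < N, ∀ i j, K k ≤ i → i ≤ j → j ≤ K (k + 1) → dist (z i) (z j) < ε)
    (hzy : ∀ k < N, dist (z (K k)) (y (J k)) < ε)
    (hzy' : ∀ k < N, dist (z (K k)) (y (J (k + 1))) < ε)
    (h : IsEpsChain ε (initialSegment y (J N) ++ (initialSegment z (K N)).reverse)) :
    IsEpsNull ε (initialSegment y (J N) ++ (initialSegment z (K N)).reverse) := by
  induction N with
  | zero =>
    refine ⟨y 0, ?_⟩
    have h' : IsEpsChain ε ([] ++ y 0 :: []) := ⟨by simp, by simp⟩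
    simpa [hJ₀, hK₀, initialSegment, h₀] using (EpsHomotopic.duplicate hε h').symm
  | succ N ih =>
    have hs := EpsHomotopic.ladder_step hε (hJ N.le_succ) (hK N.le_succ) (hy N N.lt_succ_self)
      (hz N N.lt_succ_self) (hzy' N N.lt_succ_self) (hzy N N.lt_succ_self) h
    obtain ⟨x, hx⟩ := ih (fun k hk => hy k (hk.trans N.lt_succ_self))
      (fun k hk => hz k (hk.trans N.lt_succ_self)) (fun k hk => hzy k (hk.trans N.lt_succ_self))
      (fun k hk => hzy' k (hk.trans N.lt_succ_self)) hs.2.1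
    exact ⟨x, hs.trans hx⟩

theorem exists_blocks {y : ℕ → X} {M N : ℕ} {c η : ℝ} (hc : 0 < c) (hη : 0 < η)
    (hstep : ∀ i < M, dist (y i) (y (i + 1)) < η)
    (hsum : ∑ i ∈ Finset.range M, dist (y i) (y (i + 1)) < N * c) :
    ∃ J : ℕ → ℕ, Monotone J ∧ J 0 = 0 ∧ J N = M ∧
      ∀ k i j, J k ≤ i → i ≤ j → j ≤ J (k + 1) → dist (y i) (y j) < c + η := by
  classical
  set S : ℕ → ℝ := fun n => ∑ i ∈ Finset.range n, dist (y i) (y (i + 1)) with hS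
  have hSmono : Monotone S := monotone_nat_of_le_succ fun n => by
    simp [hS, Finset.sum_range_succ]
  have hdist : ∀ i j, i ≤ j → dist (y i) (y j) ≤ S j - S i := fun i j hij => by
    rw [hS, ← Finset.sum_Ico_eq_sub _ hij]
    exact dist_le_Ico_sum_dist y hij
  -- Block `k` starts where the accumulated length first reaches `k * c`, capped at `M`. The last
  -- step of a block may overshoot, which costs the extra `η`.
  have hex : ∀ k : ℕ, ∃ j, j = M ∨ k * c ≤ S j := fun k => ⟨M, .inl rfl⟩
  have hJM : ∀ k, Nat.find (hex k) ≤ M := fun k => Nat.find_min' _ (.inl rfl)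
  refine ⟨fun k => Nat.find (hex k), ?_, ?_, ?_, ?_⟩
  · refine monotone_nat_of_le_succ fun k => Nat.find_min' _ ?_
    refine (Nat.find_spec (hex (k + 1))).imp id fun h => le_trans ?_ h
    push_cast
    nlinarith
  · exact (Nat.find_eq_zero _).2 (.inr (by simp [hS]))
  · rcases Nat.find_spec (hex N) with h | h
    · exact h
    · exact absurd ((hSmono (hJM N)).trans_lt hsum) (not_lt.2 h)
  · intro k i j hi hij hj
    have hjM := hj.trans (hJM (k + 1))
    rcases Nat.find_spec (hex k) with h | h
    · have : i = j := by simp only at hi; omega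
      subst this
      simpa using by positivity
    · have hSi : k * c ≤ S i := h.trans (hSmono hi)
      rcases j with _ | j
      · have : i = 0 := by omega
        subst this
        simpa using by positivity
      · have hlt := Nat.find_min (hex (k + 1)) (m := j) (by simp only at hj; omega)
        push Not at hlt
        have h₁ := hlt.2
        have h₂ : S (j + 1) = S j + dist (y j) (y (j + 1)) := by simp [hS, Finset.sum_range_succ]
        have h₃ := hstep j (by omega)
        have h₄ := hdist i (j + 1) hij
        push_cast at h₁
        nlinarith

end Segments

/-! ### Products along chains -/

section ChainProduct

variable {X M : Type*} [Monoid M]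

/-- The product of `e` over the steps of a chain, the later steps standing further left. -/
def chainProd (e : X → X → M) : List X → M
  | [] => 1
  | [_] => 1
  | a :: b :: l => chainProd e (b :: l) * e a b

theorem chainProd_append_cons (e : X → X → M) (l r : List X) (a : X) :
    chainProd e (l ++ a :: r) = chainProd e (a :: r) * chainProd e (l ++ [a]) := by
  induction l with
  | nil => simp [chainProd]
  | cons b l ih =>
    cases l with
    | nil => simp [chainProd]
    | cons c l => simpa [chainProd, mul_assoc] using congrArg (· * e b c) ih

theorem chainProd_initialSegment_succ (e : X → X → M) (y : ℕ → X) (n : ℕ) :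
    chainProd e (initialSegment y (n + 1)) =
      e (y n) (y (n + 1)) * chainProd e (initialSegment y n) := by
  rw [initialSegment_succ, initialSegment_eq_append, List.append_assoc, List.singleton_append,
    chainProd_append_cons]
  simp [chainProd]

theorem chainProd_reverse_mul {e : X → X → M} {l : List X}
    (h : l.IsChain fun a b => e b a * e a b = 1) :
    chainProd e l.reverse * chainProd e l = 1 := by
  induction l with
  | nil => simp [chainProd]
  | cons a l ih =>
    cases l with
    | nil => simp [chainProd]
    | cons b l =>
      rw [List.isChain_cons_cons] at h
      have h₁ := ih h.2
      simp only [List.reverse_cons, List.append_assoc, List.singleton_append] at h₁ ⊢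
      rw [chainProd_append_cons]
      simp only [chainProd, one_mul]
      calc _ = e b a * (chainProd e (l.reverse ++ [b]) * chainProd e (b :: l)) * e a b := by
            simp only [mul_assoc]
        _ = 1 := by rw [h₁, mul_one, h.1]

theorem chainProd_initialSegment_append_reverse {e : X → X → M} (he : ∀ a, e a a = 1)
    {y z : ℕ → X} {m n : ℕ} (h : y m = z n) :
    chainProd e (initialSegment y m ++ (initialSegment z n).reverse) =
      chainProd e (initialSegment z n).reverse * chainProd e (initialSegment y m) := by
  have hz : (initialSegment z n).reverse = z n :: ((List.range n).map z).reverse := by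
    simp [initialSegment_eq_append]
  rw [hz, initialSegment_eq_append, List.append_assoc, List.singleton_append,
    chainProd_append_cons]
  simp [chainProd, h, he]

end ChainProduct

/-! ### Invariance of the product under moves -/

section Invariance

variable {X M : Type*} [MetricSpace X] [Monoid M] {δ : ℝ} {e : X → X → M} {α β : List X}

/-- A point added at either end must repeat the endpoint and contributes `e a a = 1`; an interior
one is absorbed by the triangle relation. -/
theorem AddsPoint.chainProd_eq (hrefl : ∀ a, e a a = 1)
    (htri : ∀ a p b, dist a p < δ → dist p b < δ → dist a b < δ → e a b = e p b * e a p)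
    (h : AddsPoint δ α β) : chainProd e α = chainProd e β := by
  obtain ⟨hα, hβ, hh, hl, a, b, p, rfl, rfl⟩ := h
  rcases a.eq_nil_or_concat' with rfl | ⟨a, x, rfl⟩
  · cases b with
    | nil => exact absurd rfl hα.1
    | cons y b =>
      obtain rfl : y = p := by simpa using hh
      simp [chainProd, hrefl]
  · cases b with
    | nil =>
      obtain rfl : x = p := by simpa using hl
      simp only [List.append_assoc, List.singleton_append]
      rw [chainProd_append_cons _ _ [x]]
      simp [chainProd, hrefl]
    | cons y b =>
      have h₁ := hα.2
      have h₂ := hβ.2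
      simp only [List.append_assoc, List.singleton_append, List.isChain_append_cons_cons,
        List.isChain_cons_cons] at h₁ h₂ ⊢
      rw [chainProd_append_cons _ _ (y :: b), chainProd_append_cons _ _ (p :: y :: b)]
      simp only [chainProd]
      rw [htri x p y h₂.2.1 h₂.2.2.1 h₁.2.1]
      simp only [mul_assoc]

theorem EpsHomotopic.chainProd_eq (hrefl : ∀ a, e a a = 1)
    (htri : ∀ a p b, dist a p < δ → dist p b < δ → dist a b < δ → e a b = e p b * e a p)
    (h : EpsHomotopic δ α β) : chainProd e α = chainProd e β := by
  obtain ⟨-, -, h⟩ := h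
  induction h with
  | refl => rfl
  | tail _ hs ih =>
    exact ih.trans (hs.elim (·.chainProd_eq hrefl htri) fun hs => (hs.chainProd_eq hrefl htri).symm)

theorem IsEpsNull.chainProd_eq_one (hrefl : ∀ a, e a a = 1)
    (htri : ∀ a p b, dist a p < δ → dist p b < δ → dist a b < δ → e a b = e p b * e a p)
    (h : IsEpsNull δ α) : chainProd e α = 1 := by
  obtain ⟨x, hx⟩ := h
  rw [hx.chainProd_eq hrefl htri, chainProd]

end Invariance

/-! ### Paths in small balls -/

section SmallPaths

theorem eq_of_trans_trans_symm_eq_refl {X : Type*} [TopologicalSpace X] {x a b : X}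
    (S : Path.Homotopic.Quotient x a) (P Q : Path.Homotopic.Quotient a b)
    (h : (S.trans (P.trans Q.symm)).trans S.symm = .refl x) : P = Q := by
  have h' := congrArg (fun g => (S.symm.trans g).trans (S.trans Q)) h
  simp only [Path.Homotopic.Quotient.trans_assoc, Path.Homotopic.Quotient.refl_trans] at h'
  simpa only [← Path.Homotopic.Quotient.trans_assoc, Path.Homotopic.Quotient.symm_trans,
    Path.Homotopic.Quotient.refl_trans, Path.Homotopic.Quotient.trans_refl,
    Path.Homotopic.Quotient.trans_assoc Q.symm, Path.Homotopic.Quotient.trans_assoc P] using h'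

variable {X : Type*} [MetricSpace X]

theorem IsGeodesicSpace.exists_path (hgeo : IsGeodesicSpace X) (x y : X) :
    ∃ p : Path x y, Set.range p ⊆ Metric.closedBall x (dist x y) := by
  obtain ⟨c, h₀, h₁, hc⟩ := hgeo x y
  have hmem : ∀ t : unitInterval, (t : ℝ) * dist x y ∈ Set.Icc 0 (dist x y) := fun t =>
    ⟨mul_nonneg t.2.1 dist_nonneg, mul_le_of_le_one_left dist_nonneg t.2.2⟩
  have hcont : ContinuousOn c (Set.Icc 0 (dist x y)) := by
    refine (LipschitzOnWith.of_dist_le_mul (K := 1) fun s hs t ht => ?_).continuousOn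
    rw [hc s hs t ht, Real.dist_eq, NNReal.coe_one, one_mul]
  refine ⟨⟨⟨fun t => c (t * dist x y), ?_⟩, by simpa using h₀, by simpa using h₁⟩, ?_⟩
  · exact hcont.comp_continuous (by fun_prop) hmem
  · rintro _ ⟨t, rfl⟩
    change dist (c (t * dist x y)) x ≤ dist x y
    have h := hc _ (hmem t) 0 ⟨le_rfl, dist_nonneg⟩
    rw [h₀, sub_zero, abs_of_nonneg (hmem t).1] at h
    exact h.trans_le (hmem t).2

theorem exists_pos_homotopic_of_subset_ball [CompactSpace X] (hgeo : IsGeodesicSpace X)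
    (hslsc : IsSemilocallySimplyConnected X) :
    ∃ r > 0, ∀ (c a b : X) (p q : Path a b), Set.range p ⊆ Metric.ball c r →
      Set.range q ⊆ Metric.ball c r → p.Homotopic q := by
  choose U hU hnull using hslsc
  choose ρ hρ hball using fun x => Metric.mem_nhds_iff.1 (hU x)
  obtain ⟨r, hr, hleb⟩ := lebesgue_number_lemma_of_metric (isCompact_univ (X := X))
    (c := fun x => Metric.ball x (ρ x)) (fun _ => Metric.isOpen_ball)
    fun x _ => Set.mem_iUnion.2 ⟨x, Metric.mem_ball_self (hρ x)⟩
  refine ⟨r, hr, fun c a b p q hp hq => ?_⟩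
  obtain ⟨x, hx⟩ := hleb c (Set.mem_univ c)
  obtain ⟨s, hs⟩ := hgeo.exists_path x a
  have ha : a ∈ Metric.ball x (ρ x) := hx (hp ⟨0, p.source⟩)
  have hsx : Set.range s ⊆ Metric.ball x (ρ x) :=
    hs.trans (Metric.closedBall_subset_ball (by rwa [dist_comm]))
  -- The hypothesis only concerns loops based at the center `x`, so the loop `p q⁻¹` is conjugated
  -- by a geodesic from `x` that stays in the ball.
  have hloop := hnull x ((s.trans (p.trans q.symm)).trans s.symm) (by
    refine Set.Subset.trans ?_ (hball x)
    simp only [Path.trans_range, Path.symm_range]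
    exact Set.union_subset (Set.union_subset hsx (Set.union_subset (hp.trans hx) (hq.trans hx)))
      hsx)
  rw [← Path.Homotopic.Quotient.eq] at hloop ⊢
  simp only [Path.Homotopic.Quotient.mk_trans, Path.Homotopic.Quotient.mk_symm,
    Path.Homotopic.Quotient.mk_refl] at hloop
  exact eq_of_trans_trans_symm_eq_refl _ _ _ hloop

end SmallPaths

/-! ### Transport of paths to loops at a basepoint -/

section Transport

variable {X : Type*} [TopologicalSpace X] {o : X}

/-- The loop at `o` obtained from a path by joining its endpoints to `o`. -/
noncomputable def loopClass (τ : ∀ a : X, Path o a) {a b : X} (p : Path a b) :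
    FundamentalGroup X o :=
  ((Path.Homotopic.Quotient.mk (τ a)).trans (Path.Homotopic.Quotient.mk p)).trans
    (Path.Homotopic.Quotient.mk (τ b)).symm

variable (τ : ∀ a : X, Path o a) {a b c : X}

theorem loopClass_congr {p q : Path a b} (h : p.Homotopic q) : loopClass τ p = loopClass τ q := by
  rw [loopClass, loopClass, Path.Homotopic.Quotient.eq.2 h]

theorem loopClass_refl : loopClass τ (Path.refl a) = 1 := by
  rw [loopClass, Path.Homotopic.Quotient.mk_refl, Path.Homotopic.Quotient.trans_refl,
    Path.Homotopic.Quotient.trans_symm]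
  rfl

theorem loopClass_trans (p : Path a b) (q : Path b c) :
    loopClass τ (p.trans q) = loopClass τ q * loopClass τ p := by
  rw [FundamentalGroup.mul_def]
  simp only [loopClass, Path.Homotopic.Quotient.mk_trans, Path.Homotopic.Quotient.trans_assoc]
  rw [← Path.Homotopic.Quotient.trans_assoc (Path.Homotopic.Quotient.mk (τ b)).symm,
    Path.Homotopic.Quotient.symm_trans, Path.Homotopic.Quotient.refl_trans]

theorem loopClass_cast {a' b' : X} (p : Path a b) (ha : a' = a) (hb : b' = b) :
    loopClass τ (p.cast ha hb) = loopClass τ p := by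
  subst ha hb
  rfl

theorem homotopic_of_loopClass_eq {p q : Path a b} (h : loopClass τ p = loopClass τ q) :
    p.Homotopic q := by
  rw [← Path.Homotopic.Quotient.eq]
  have h' := congrArg (fun g : Path.Homotopic.Quotient o o =>
    ((Path.Homotopic.Quotient.mk (τ a)).symm.trans g).trans (Path.Homotopic.Quotient.mk (τ b))) h
  simp only [loopClass, Path.Homotopic.Quotient.trans_assoc, Path.Homotopic.Quotient.symm_trans,
    Path.Homotopic.Quotient.trans_refl] at h'
  simpa only [← Path.Homotopic.Quotient.trans_assoc, Path.Homotopic.Quotient.symm_trans,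
    Path.Homotopic.Quotient.refl_trans] using h'

end Transport

/-! ### From paths to chains and back -/

section Discretization

variable {X : Type*} [MetricSpace X]

theorem exists_subdivision {a b : X} (γ : Path a b) {δ : ℝ} (hδ : 0 < δ) :
    ∃ (t : ℕ → unitInterval) (M : ℕ), t 0 = 0 ∧ t M = 1 ∧ Monotone t ∧
      ∀ i, γ '' Set.Icc (t i) (t (i + 1)) ⊆ Metric.ball (γ (t i)) δ := by
  obtain ⟨t, h₀, hmono, ⟨M, hM⟩, ht⟩ := exists_monotone_Icc_subset_open_cover_unitInterval
    (c := fun x => γ ⁻¹' Metric.ball x (δ / 2)) (fun _ => Metric.isOpen_ball.preimage γ.continuous)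
    fun s _ => Set.mem_iUnion.2 ⟨γ s, Metric.mem_ball_self (half_pos hδ)⟩
  refine ⟨t, M, h₀, hM M le_rfl, hmono, fun i => ?_⟩
  obtain ⟨x, hx⟩ := ht i
  rintro _ ⟨s, hs, rfl⟩
  have h₁ : dist (γ s) x < δ / 2 := hx hs
  have h₂ : dist (γ (t i)) x < δ / 2 := hx ⟨le_rfl, hmono i.le_succ⟩
  rw [Metric.mem_ball]
  linarith [dist_triangle_right (γ s) (γ (t i)) x]

/-- A path of length less than `N * c` admits arbitrarily fine subdivisions that group into `N`
blocks whose points are within about `c` of each other. -/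
theorem exists_subdivision_blocks {a b : X} (γ : Path a b) {δ c : ℝ} (hδ : 0 < δ) (hc : 0 < c)
    {N : ℕ} (hγ : pathLength γ < ENNReal.ofReal (N * c)) :
    ∃ (t : ℕ → unitInterval) (J : ℕ → ℕ), t 0 = 0 ∧ t (J N) = 1 ∧ Monotone t ∧
      (∀ i, γ '' Set.Icc (t i) (t (i + 1)) ⊆ Metric.ball (γ (t i)) δ) ∧
      Monotone J ∧ J 0 = 0 ∧
      ∀ k i j, J k ≤ i → i ≤ j → j ≤ J (k + 1) → dist (γ (t i)) (γ (t j)) < c + δ := by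
  obtain ⟨t, M, h₀, hM, hmono, ht⟩ := exists_subdivision γ hδ
  have hstep : ∀ i, dist (γ (t i)) (γ (t (i + 1))) < δ := fun i => by
    rw [dist_comm]
    exact ht i ⟨_, ⟨hmono i.le_succ, le_rfl⟩, rfl⟩
  have hsum : ∑ i ∈ Finset.range M, dist (γ (t i)) (γ (t (i + 1))) < N * c := by
    have h := (eVariationOn.sum_le (f := γ) (s := Set.univ) (n := M) hmono
      fun _ => Set.mem_univ _).trans_lt hγ
    simp only [edist_dist] at h
    rw [← ENNReal.ofReal_sum_of_nonneg fun _ _ => dist_nonneg] at h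
    simpa only [dist_comm] using (ENNReal.ofReal_lt_ofReal_iff_of_nonneg
      (Finset.sum_nonneg fun _ _ => dist_nonneg)).1 h
  obtain ⟨J, hJ, hJ₀, hJN, hblock⟩ :=
    exists_blocks (y := fun i => γ (t i)) hc hδ (fun i _ => hstep i) hsum
  exact ⟨t, J, h₀, by rw [hJN, hM], hmono, ht, hJ, hJ₀, hblock⟩

theorem chainProd_subdivision {o a b : X} (τ : ∀ x : X, Path o x)
    (σ : ∀ x y : X, Path x y) (γ : Path a b) {t : ℕ → unitInterval} (h₀ : t 0 = 0)
    (ht : ∀ i, (γ.subpath (t i) (t (i + 1))).Homotopic (σ (γ (t i)) (γ (t (i + 1))))) (n : ℕ) :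
    chainProd (fun x y => loopClass τ (σ x y)) (initialSegment (fun i => γ (t i)) n) =
      loopClass τ (γ.subpath 0 (t n)) := by
  induction n with
  | zero =>
    -- The type of the subpath depends on `t 0`, so the endpoint is generalized before substituting.
    have h : ∀ s, s = 0 → loopClass τ (γ.subpath 0 s) = 1 := by
      rintro _ rfl
      rw [Path.subpath_self, loopClass_refl]
    rw [h _ h₀]
    rfl
  | succ n ih =>
    rw [chainProd_initialSegment_succ, ih, ← loopClass_congr τ (ht n), ← loopClass_trans]
    exact loopClass_congr τ ⟨Path.Homotopy.subpathTransSubpath γ _ _ _⟩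

/-- If the loop formed by fine subdivisions of two paths is null at a sufficiently small scale,
then the paths are homotopic. -/
theorem homotopic_of_isEpsNull (hgeo : IsGeodesicSpace X) {r δ : ℝ}
    (hr : ∀ (c a b : X) (p q : Path a b), Set.range p ⊆ Metric.ball c r →
      Set.range q ⊆ Metric.ball c r → p.Homotopic q) (hδ : 0 < δ) (hδr : 2 * δ ≤ r)
    {a b : X} (γ γ' : Path a b) {t t' : ℕ → unitInterval} {m n : ℕ}
    (h₀ : t 0 = 0) (hm : t m = 1) (hmono : Monotone t)
    (ht : ∀ i, γ '' Set.Icc (t i) (t (i + 1)) ⊆ Metric.ball (γ (t i)) δ)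
    (h₀' : t' 0 = 0) (hn : t' n = 1) (hmono' : Monotone t')
    (ht' : ∀ i, γ' '' Set.Icc (t' i) (t' (i + 1)) ⊆ Metric.ball (γ' (t' i)) δ)
    (hnull : IsEpsNull δ (initialSegment (fun i => γ (t i)) m ++
      (initialSegment (fun i => γ' (t' i)) n).reverse)) :
    γ.Homotopic γ' := by
  choose σ hσ using hgeo.exists_path
  set e : X → X → FundamentalGroup X a := fun x y => loopClass (σ a) (σ x y) with he
  have hσr : ∀ x y z : X, dist x z + dist x y < r → Set.range (σ x y) ⊆ Metric.ball z r :=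
    fun x y z h => (hσ x y).trans fun w hw => by
      rw [Metric.mem_closedBall] at hw
      rw [Metric.mem_ball]
      linarith [dist_triangle w x z]
  have hrefl : ∀ x, e x x = 1 := fun x => by
    rw [he, ← loopClass_refl (σ a) (a := x)]
    refine loopClass_congr _ (hr x _ _ _ _ (hσr _ _ _ (by simp; linarith)) ?_)
    rintro _ ⟨s, rfl⟩
    exact Metric.mem_ball_self (by linarith)
  -- All three geodesics lie within `2 * δ ≤ r` of `x`, where paths with common endpoints are
  -- homotopic.
  have htri : ∀ x p y, dist x p < δ → dist p y < δ → dist x y < δ → e x y = e p y * e x p := by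
    intro x p y hxp hpy hxy
    rw [he, ← loopClass_trans]
    refine loopClass_congr _ (hr x _ _ _ _ (hσr _ _ _ (by simp; linarith)) ?_)
    rw [Path.trans_range]
    exact Set.union_subset (hσr _ _ _ (by simp; linarith))
      (hσr _ _ _ (by rw [dist_comm p x]; linarith))
  have hinv : ∀ x y, dist x y < δ → e y x * e x y = 1 := fun x y hxy => by
    rw [← htri x y x hxy (by rwa [dist_comm]) (by simpa), hrefl]
  have hsub : ∀ (η : Path a b) (u : ℕ → unitInterval), Monotone u →
      (∀ i, η '' Set.Icc (u i) (u (i + 1)) ⊆ Metric.ball (η (u i)) δ) →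
      ∀ i, (η.subpath (u i) (u (i + 1))).Homotopic (σ (η (u i)) (η (u (i + 1)))) := by
    intro η u hu hη i
    refine hr (η (u i)) _ _ _ _ ?_ (hσr _ _ _ ?_)
    · rw [Path.range_subpath_of_le _ _ _ (hu i.le_succ)]
      exact (hη i).trans (Metric.ball_subset_ball (by linarith))
    · have : dist (η (u (i + 1))) (η (u i)) < δ := hη i ⟨_, ⟨hu i.le_succ, le_rfl⟩, rfl⟩
      rw [dist_self, dist_comm]
      linarith
  have hprod : ∀ (η : Path a b) (u : ℕ → unitInterval) (k : ℕ), u 0 = 0 → u k = 1 → Monotone u →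
      (∀ i, η '' Set.Icc (u i) (u (i + 1)) ⊆ Metric.ball (η (u i)) δ) →
      chainProd e (initialSegment (fun i => η (u i)) k) = loopClass (σ a) η := by
    intro η u k h₀ h₁ hu hη
    rw [he, chainProd_subdivision (σ a) σ η h₀ (hsub η u hu hη) k, h₁,
      Path.subpath_zero_one, loopClass_cast]
  have h₁ := hnull.chainProd_eq_one hrefl htri
  rw [chainProd_initialSegment_append_reverse hrefl (by simp [hm, hn])] at h₁
  have h₂ := chainProd_reverse_mul (e := e) (l := initialSegment (fun i => γ' (t' i)) n)
    (isChain_initialSegment fun i _ => hinv _ _ (by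
      rw [dist_comm]
      exact ht' i ⟨_, ⟨hmono' i.le_succ, le_rfl⟩, rfl⟩))
  rw [hprod γ t m h₀ hm hmono ht] at h₁
  rw [hprod γ' t' n h₀' hn hmono' ht'] at h₂
  -- The reversed `γ'` chain has a product that is a left inverse of both loop classes.
  exact homotopic_of_loopClass_eq (σ a) (mul_left_cancel (h₁.trans h₂.symm))

theorem isEpsLoop_initialSegment_append_reverse {δ : ℝ} (hδ : 0 < δ) {y z : ℕ → X} {m n : ℕ}
    (hy : ∀ i < m, dist (y i) (y (i + 1)) < δ) (hz : ∀ i < n, dist (z i) (z (i + 1)) < δ)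
    (h₀ : y 0 = z 0) (h : y m = z n) :
    IsEpsLoop δ (initialSegment y m ++ (initialSegment z n).reverse) := by
  refine ⟨⟨by simp [initialSegment], ?_⟩, ?_⟩
  · have hy' := isChain_initialSegment (R := fun a b => dist a b < δ) hy
    have hz' : (initialSegment z n).reverse.IsChain fun a b => dist a b < δ :=
      (IsEpsChain.reverse ⟨by simp [initialSegment],
        isChain_initialSegment (R := fun a b => dist a b < δ) hz⟩).2
    refine List.isChain_append.2 ⟨hy', hz', ?_⟩
    intro a ha b hb
    simp only [initialSegment_eq_append, List.reverse_append, List.getLast?_append,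
      List.getLast?_singleton, List.reverse_cons, List.reverse_nil, List.nil_append,
      List.singleton_append, List.head?_cons, Option.mem_def, Option.some_or,
      Option.some.injEq] at ha hb
    rw [← ha, ← hb, h, dist_self]
    exact hδ
  · simp [initialSegment, List.range_succ_eq_map, List.getLast?_append, List.getLast?_cons, h₀]

end Discretization

/-! ### Encoding short classes by ball centers -/

section Counting

variable {X : Type*} [MetricSpace X]

theorem encard_short_classes_le [CompactSpace X] (hgeo : IsGeodesicSpace X)
    (hslsc : IsSemilocallySimplyConnected X) {ε : ℝ} (hε : 0 < ε)
    (hlower : ε ∈ lowerBounds (homotopyCriticalSpectrum X)) {L : ℝ} {n : ℕ}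
    (hn : 4 * L / ε ≤ n + 1) {A : Set X} (hA : (⋃ a ∈ A, Metric.ball a (ε / 4)) = Set.univ)
    (x : X) :
    {g : FundamentalGroup X x | classLength g.toPath ≤ ENNReal.ofReal L}.encard ≤
      A.encard ^ n := by
  obtain ⟨r, hr, hsmall⟩ := exists_pos_homotopic_of_subset_ball hgeo hslsc
  obtain ⟨δ, hδ, hδr, hδε⟩ : ∃ δ > 0, 2 * δ ≤ r ∧ δ ≤ ε / 16 :=
    ⟨min (r / 2) (ε / 16), by positivity, by linarith [min_le_left (r / 2) (ε / 16)],
      min_le_right _ _⟩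
  -- The slack `ε / 16` makes the bound strict, so the infimum yields an actual path. With `δ ≤ ε /
  -- 16`, blocks still have diameter below `3ε / 8 < ε / 2`.
  have hlen : ENNReal.ofReal L < ENNReal.ofReal ((n + 1 : ℕ) * (ε / 4 + ε / 16)) := by
    rw [div_le_iff₀ hε] at hn
    refine (ENNReal.ofReal_lt_ofReal_iff (by positivity)).2 ?_
    push_cast
    have : 0 ≤ (n : ℝ) * ε := by positivity
    linarith
  set S := {g : FundamentalGroup X x | classLength g.toPath ≤ ENNReal.ofReal L}
  have hpath : ∀ g : S, ∃ γ : Path x x, Path.Homotopic.Quotient.mk γ = g.1.toPath ∧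
      pathLength γ < ENNReal.ofReal ((n + 1 : ℕ) * (ε / 4 + ε / 16)) := fun g => by
    have h := (show classLength g.1.toPath ≤ _ from g.2).trans_lt hlen
    rw [classLength] at h
    simpa only [iInf_lt_iff, exists_prop] using h
  choose γ hγ hγL using hpath
  choose t J ht₀ ht₁ htm ht hJ hJ₀ hblock using fun g =>
    exists_subdivision_blocks (γ g) hδ (by positivity) (hγL g)
  have hcover : ∀ y : X, ∃ a : A, dist y a < ε / 4 := fun y => by
    have := hA ▸ Set.mem_univ y
    simpa using this
  choose center hcenter using hcover
  -- Only the cut points `1, ..., n` are coded; `0` and `n + 1` are the basepoint, which keeps the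
  -- exponent at most `4L/ε`.
  let f : S → Fin n → A := fun g k => center (γ g (t g (J g (k + 1))))
  have hf : Function.Injective f := by
    intro g h hgh
    have hnear : ∀ k ≤ n + 1, dist (γ h (t h (J h k))) (γ g (t g (J g k))) < ε / 2 := by
      intro k hk
      rcases k with _ | k
      · simp [hJ₀, ht₀, hε]
      · rcases Nat.lt_or_ge k n with hkn | hkn
        · have h₁ : center (γ g (t g (J g (k + 1)))) = center (γ h (t h (J h (k + 1)))) :=
            congrFun hgh ⟨k, hkn⟩
          have h₂ := hcenter (γ g (t g (J g (k + 1))))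
          have h₃ := hcenter (γ h (t h (J h (k + 1))))
          rw [h₁] at h₂
          exact (dist_triangle_right _ _ _).trans_lt ((add_lt_add h₃ h₂).trans_eq (by ring))
        · obtain rfl : k = n := by omega
          simp [ht₁, hε]
    have hstep : ∀ (g : S) i, dist (γ g (t g i)) (γ g (t g (i + 1))) < δ := fun g i => by
      rw [dist_comm]
      exact ht g i ⟨_, ⟨htm g i.le_succ, le_rfl⟩, rfl⟩
    have hb : ∀ (g : S) k i j, J g k ≤ i → i ≤ j → j ≤ J g (k + 1) →
        dist (γ g (t g i)) (γ g (t g j)) < ε / 2 := fun g k i j hi hij hj =>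
      (hblock g k i j hi hij hj).trans_le (by linarith)
    have hloop := isEpsLoop_initialSegment_append_reverse (m := J g (n + 1)) (n := J h (n + 1)) hδ
      (fun i _ => hstep g i) (fun i _ => hstep h i) (by simp [ht₀]) (by simp [ht₁])
    have hnull := IsEpsNull.of_ladder hε (hJ g) (hJ h) (hJ₀ g) (hJ₀ h) (by simp [ht₀])
      (fun k _ i j hi hij hj => (hb g k i j hi hij hj).trans (by linarith))
      (fun k _ i j hi hij hj => (hb h k i j hi hij hj).trans (by linarith))
      (fun k hk => (hnear k hk.le).trans (by linarith))
      (fun k hk => (dist_triangle _ (γ g (t g (J g k))) _).trans_lt (by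
        linarith [hnear k hk.le, hb g k _ _ le_rfl (hJ g k.le_succ) le_rfl]))
      (hloop.1.mono (hδε.trans (by linarith)))
    have hhom := homotopic_of_isEpsNull hgeo hsmall hδ hδr (γ g) (γ h) (ht₀ g) (ht₁ g) (htm g)
      (ht g) (ht₀ h) (ht₁ h) (htm h) (ht h) (hnull.of_mem_lowerBounds hlower hδ hloop)
    exact Subtype.ext (((hγ g).symm.trans (Path.Homotopic.Quotient.eq.2 hhom)).trans (hγ h))
  have hcard := ENat.card_le_card_of_injective hf
  rwa [ENat.card_fun, ENat.card_coe_set_eq, ENat.card_coe_set_eq, ENat.card_eq_coe_fintype_card,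
    Fintype.card_fin, ENat.epow_natCast] at hcard

variable (X) in
-- An infimum over a nonempty family in the well-ordered `ℕ∞` is attained.
theorem exists_cover_encard_eq_openCoverNumber {s : ℝ} (hs : 0 < s) :
    ∃ A : Set X, (⋃ a ∈ A, Metric.ball a s) = Set.univ ∧ A.encard = openCoverNumber X s := by
  have : Nonempty {A : Set X // (⋃ a ∈ A, Metric.ball a s) = Set.univ} :=
    ⟨Set.univ, Set.eq_univ_of_forall fun x =>
      Set.mem_biUnion (Set.mem_univ x) (Metric.mem_ball_self hs)⟩
  obtain ⟨A, hA⟩ := ciInf_mem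
    fun A : {A : Set X // (⋃ a ∈ A, Metric.ball a s) = Set.univ} => A.1.encard
  refine ⟨A.1, A.2, ?_⟩
  rw [openCoverNumber, iInf_subtype']
  exact hA

end Counting

end DiscreteHomotopy

theorem corollary4 (X : Type*) [MetricSpace X] [CompactSpace X]
    (hgeo : DiscreteHomotopy.IsGeodesicSpace X)
    (hslsc : DiscreteHomotopy.IsSemilocallySimplyConnected X)
    (ε : ℝ) (hε : 0 < ε)
    (hlower : ε ∈ lowerBounds (DiscreteHomotopy.homotopyCriticalSpectrum X))
    (L : ℝ) (hL : 0 < L) :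
    (DiscreteHomotopy.shortClassCount X L : ENNReal) ≤
      (DiscreteHomotopy.openCoverNumber X (ε / 4) : ENNReal) ^ (4 * L / ε) := by
  obtain ⟨A, hA, hAcard⟩ :=
    DiscreteHomotopy.exists_cover_encard_eq_openCoverNumber X (by positivity : 0 < ε / 4)
  rcases isEmpty_or_nonempty X with hX | ⟨⟨x₀⟩⟩
  · simp [DiscreteHomotopy.shortClassCount]
  have hpos : 0 < 4 * L / ε := by positivity
  obtain ⟨n, hn⟩ : ∃ n, ⌈4 * L / ε⌉₊ = n + 1 :=
    Nat.exists_eq_succ_of_ne_zero (Nat.ceil_pos.2 hpos).ne'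
  have hle : 4 * L / ε ≤ n + 1 := by exact_mod_cast hn ▸ Nat.le_ceil (4 * L / ε)
  have hge : (n : ℝ) ≤ 4 * L / ε := by
    have h := Nat.ceil_lt_add_one hpos.le
    rw [hn] at h
    push_cast at h
    linarith
  have hcount : DiscreteHomotopy.shortClassCount X L ≤
      DiscreteHomotopy.openCoverNumber X (ε / 4) ^ n :=
    iSup_le fun x =>
      hAcard ▸ DiscreteHomotopy.encard_short_classes_le hgeo hslsc hε hlower hle hA x
  -- Raising the exponent from `n` to `4 * L / ε` needs a base at least `1`, hence the separate
  -- treatment of empty `X`.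
  have hone : 1 ≤ DiscreteHomotopy.openCoverNumber X (ε / 4) := by
    rw [← hAcard, Set.one_le_encard_iff_nonempty]
    have := hA ▸ Set.mem_univ x₀
    simp only [Set.mem_iUnion] at this
    obtain ⟨a, ha, -⟩ := this
    exact ⟨a, ha⟩
  calc (DiscreteHomotopy.shortClassCount X L : ENNReal)
      ≤ (DiscreteHomotopy.openCoverNumber X (ε / 4) : ENNReal) ^ n := by
        rw [← ENat.toENNReal_pow]
        exact ENat.toENNReal_le.2 hcount
    _ = (DiscreteHomotopy.openCoverNumber X (ε / 4) : ENNReal) ^ (n : ℝ) :=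
        (ENNReal.rpow_natCast _ _).symm
    _ ≤ _ := ENNReal.rpow_le_rpow_of_exponent_le (by exact_mod_cast hone) hge
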